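/- **Definitions.** A $(k,n)$-coding scheme is a randomised encoder $\mathsf{Enc}:\{0,1\}^k\to\{0,1\}^n$ together with a deterministic decoder $\mathsf{Dec}:\{0,1\}^n\to\{0,1\}^k\cup\{\bot\}$ such that $\Pr[\mathsf{Dec}(\mathsf{Enc}(m))=m]=1$ for every $m\in\{0,1\}^k$. Its rate is $k/n$. $\mathsf{SD}$ denotes statistical distance, and $x_S$ the subvector of $x\in\{0,1\}^n$ on $S\subseteq[n]$. For $\rho\in[0,1]$, let $\mathcal F^{[n],\rho,1}_{\mathrm{BIT}}$ be the set of all functions $f_{S_r,S_w,g}:\{0,1\}^n\to\{0,1\}^n$ with $S_r,S_w\subseteq[n]$, $|S_r|\le n\rho$, and $g:\{0,1\}^{S_r}\to\{\mathsf{Set0},\mathsf{Set1},\mathsf{Keep},\mathsf{Flip}\}^{S_w}$. The function $f_{S_r,S_w,g}$ applies the one-bit functions $g(x_{S_r})$ to the bits of $x$ in $S_w$ and leaves the other bits unchanged. A $(k,n)$-coding scheme is a $(\rho,1)$-active adversary wiretap II code with error $\varepsilon$ if 1. (secrecy) $\mathsf{SD}\big(\mathsf{Enc}(m_0)_S;\mathsf{Enc}(m_1)_S\big)\le\varepsilon$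 for all messages $m_0,m_1$ and all $S\subseteq[n]$ with $|S|\le n\rho$; 2. (non-malleability) for each $f\in\mathcal F^{[n],\rho,1}_{\mathrm{BIT}}$ there is a distribution $D_f$ on $\{0,1\}^k\cup\{\bot,\mathsf{same}^*\}$, efficiently samplable given oracle access to $f$, such that for every message $m$ the distribution of $\mathsf{Dec}(f(\mathsf{Enc}(m)))$ is within statistical distance $\varepsilon$ of $\mathrm{Patch}(D_f,m)$, the distribution obtained by drawing from $D_f$ and replacing the outcome $\mathsf{same}^*$ by $m$. For a family of schemes, one $(k,n(k))$-coding scheme for each $k\in\mathbb N$, "efficiently samplable" means the following. For each $k$ there is one randomised procedure, the same for all $f$, that samples $D_f$ with oracle access to $f$, and whose total number of fair coin tosses, calls to $\mathsf{Enc}$ and $\mathsf{Dec}$, and queries to $f$ is at most $p(n(k))$ for a polynomial $p$ independent of $k$. The rate achieved by the family is $\limsup_{k\to\infty}k/n(k)$. The capacity $C(\rho)$ of $(\rho,1)$-active adversary wiretap II codes is the supremum of the rates achieved by families of $(\rho,1)$-active adversary wiretap II codes with errors $\varepsilon_k\to0$. For fixed $\varepsilon$, let $C_\varepsilon(\rho)$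 be the supremum over the families all of whose members have error $\varepsilon$. The supremum of the empty set of rates is $0$. **Theorem 5.1.** Let $0\le\rho_r\le1$. The capacity of $(\rho_r,1)$-active adversary wiretap II codes is $1-\rho_r$, that is, $C(\rho_r)=1-\rho_r$, and also $C_\varepsilon(\rho_r)=1-\rho_r$ for every $0<\varepsilon<1$. If $\rho_r<1$, the capacity is achieved: there is a family of $(\rho_r,1)$-active adversary wiretap II codes with errors $\varepsilon_k\to0$ and $\lim_{k\to\infty}k/n(k)=1-\rho_r$. -/

import Mathlib

namespace WtII

open Filter Topology

noncomputable section

/-- Binary words of length `n`; messages are words of length `k`, codewords words of length `n`. -/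
abbrev Word (n : ℕ) : Type := Fin n → Bool

/-- Statistical (total variation) distance of two distributions on a finite set. -/
def statDist {α : Type} [Fintype α] (p q : PMF α) : ℝ :=
  (1 / 2) * ∑ a, |(p a).toReal - (q a).toReal|

/-- A `(k, n)`-coding scheme: a randomised encoder and a deterministic decoder, where `none` is the
symbol `⊥`, such that `Dec (Enc m) = m` with probability one. -/
structure CodingScheme (k n : ℕ) where
  enc : Word k → PMF (Word n)
  dec : Word n → Option (Word k)
  correct : ∀ m : Word k, ((enc m).map dec) (some m) = 1

/-- The subvector `x_S`. -/
def restrict {n : ℕ} (S : Finset (Fin n)) (x : Word n) : S → Bool := fun i => x i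

/-! ### Bit tampering with leakage -/

/-- The four functions that tamper with one bit. -/
inductive BitFn : Type
  | set0
  | set1
  | keep
  | flip

/-- The action of a one-bit tampering function. -/
def BitFn.app : BitFn → Bool → Bool
  | set0, _ => false
  | set1, _ => true
  | keep, b => b
  | flip, b => !b

/-- The tampering function `f_{S_r, S_w, g}`: the bits in `S_r` are read, and the vector
`g (x_{S_r})` of one-bit tampering functions is applied to the bits in `S_w`;
all other bits are left unchanged. -/
def tamperFn {n : ℕ} (Sr Sw : Finset (Fin n)) (g : (Sr → Bool) → (Sw → BitFn)) :
    Word n → Word n :=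
  fun x i => if h : i ∈ Sw then (g (restrict Sr x) ⟨i, h⟩).app (x i) else x i

/-- The family of bitwise tampering functions that read at most `n ρr` bits of the codeword and,
depending on them, tamper with at most `n ρw` bits. -/
def bitTampering (n : ℕ) (ρr ρw : ℝ) : Set (Word n → Word n) :=
  {f | ∃ (Sr Sw : Finset (Fin n)) (g : (Sr → Bool) → (Sw → BitFn)),
    (Sr.card : ℝ) ≤ n * ρr ∧ (Sw.card : ℝ) ≤ n * ρw ∧ f = tamperFn Sr Sw g}

/-! ### Non-malleability -/

/-- The tampering experiment: encode `m`, apply `f`, decode. -/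
def tamper {k n : ℕ} (C : CodingScheme k n) (f : Word n → Word n) (m : Word k) :
    PMF (Option (Word k)) :=
  (C.enc m).map fun x => C.dec (f x)

/-- The set of messages together with the two symbols `⊥` (which is `some none`) and `same*`
(which is `none`). -/
abbrev SimOutput (k : ℕ) : Type := Option (Option (Word k))

/-- `Patch (D, m)`: draw from `D` and replace the outcome `same*` by `m`. -/
def patch {k : ℕ} (D : PMF (SimOutput k)) (m : Word k) : PMF (Option (Word k)) :=
  D.map fun y => y.getD (some m)

/-- Randomised sampling procedures with oracle access to a tampering function, which may also toss
fair coins and call the encoder and the decoder of the coding scheme. The procedure itself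
(a computation tree) depends on none of these oracles, only on the answers it receives. -/
inductive Sampler (k n : ℕ) : Type
  | output (y : SimOutput k)
  | coin (next : Bool → Sampler k n)
  | callEnc (m : Word k) (next : Word n → Sampler k n)
  | callDec (x : Word n) (next : Option (Word k) → Sampler k n)
  | query (x : Word n) (next : Word n → Sampler k n)

/-- The worst-case total number of coin tosses, calls of the encoder and the decoder, and queries
to the tampering function. -/
def Sampler.cost {k n : ℕ} : Sampler k n → ℕ
  | output _ => 0
  | coin next => 1 + Finset.univ.sup fun b => (next b).cost
  | callEnc _ next => 1 + Finset.univ.sup fun x => (next x).cost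
  | callDec _ next => 1 + Finset.univ.sup fun y => (next y).cost
  | query _ next => 1 + Finset.univ.sup fun x => (next x).cost

/-- The distribution of the output of a sampling procedure for the coding scheme `C` when its
oracle is `f`. -/
def Sampler.run {k n : ℕ} (C : CodingScheme k n) (f : Word n → Word n) :
    Sampler k n → PMF (SimOutput k)
  | output y => PMF.pure y
  | coin next => (PMF.uniformOfFintype Bool).bind fun b => (next b).run C f
  | callEnc m next => (C.enc m).bind fun x => (next x).run C f
  | callDec x next => (next (C.dec x)).run C f
  | query x next => (next (f x)).run C f

/-- Non-malleability with respect to `F` with exact security `ε`: for each `f ∈ F` there is a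
distribution `D_f` on messages, `⊥` and `same*` such that, for every message `m`, the tampering
experiment is `ε`-close to `Patch (D_f, m)`. All `D_f` are sampled by one procedure of cost at
most `t` that has oracle access to `f`. -/
def IsNonMalleable {k n : ℕ} (C : CodingScheme k n) (F : Set (Word n → Word n)) (ε : ℝ)
    (t : ℕ) : Prop :=
  ∃ A : Sampler k n, A.cost ≤ t ∧
    ∀ f ∈ F, ∃ D : PMF (SimOutput k), D = A.run C f ∧
      ∀ m : Word k, statDist (tamper C f m) (patch D m) ≤ ε

/-! ### Active adversary wiretap II codes -/

/-- Indistinguishability against an eavesdropper who reads at most `n ρ` codeword bits. -/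
def IsSecret {k n : ℕ} (C : CodingScheme k n) (ρ ε : ℝ) : Prop :=
  ∀ (m₀ m₁ : Word k) (S : Finset (Fin n)), (S.card : ℝ) ≤ n * ρ →
    statDist ((C.enc m₀).map (restrict S)) ((C.enc m₁).map (restrict S)) ≤ ε

/-- A `(ρ, 1)`-active adversary wiretap II code with security error `ε` (for both security
properties), where the simulated distributions are sampled at cost at most `t`. -/
def IsActiveCode {k n : ℕ} (C : CodingScheme k n) (ρ ε : ℝ) (t : ℕ) : Prop :=
  IsSecret C ρ ε ∧ IsNonMalleable C (bitTampering n ρ 1) ε t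

/-- A family of `(k, n(k))`-coding schemes, one for every message length `k`. -/
structure CodeFamily where
  len : ℕ → ℕ
  code : ∀ k : ℕ, CodingScheme k (len k)

/-- The rate `k / n(k)` of the `k`-th scheme of a family. -/
def CodeFamily.rate (𝒞 : CodeFamily) (k : ℕ) : ℝ := (k : ℝ) / (𝒞.len k : ℝ)

/-- The rate achieved by a family as the message length grows to infinity. All rates `k / n(k)` lie
in `[0, 1]`, because decoding is correct. -/
def CodeFamily.achievedRate (𝒞 : CodeFamily) : ℝ := limsup 𝒞.rate atTop

/-- Every scheme of the family is a `(ρ, 1)`-active adversary wiretap II code, with error `ε k` for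
message length `k`; the cost of sampling is polynomial in the codeword length. -/
def CodeFamily.IsActive (𝒞 : CodeFamily) (ρ : ℝ) (ε : ℕ → ℝ) : Prop :=
  ∃ p : Polynomial ℕ, ∀ k : ℕ, IsActiveCode (𝒞.code k) ρ (ε k) (p.eval (𝒞.len k))

/-- The capacity for vanishing error: the supremum of the rates that are achieved by families of
`(ρ, 1)`-active adversary wiretap II codes whose error tends to zero
(`0` if there is no such family). -/
def capacity (ρ : ℝ) : ℝ :=
  sSup {R : ℝ | ∃ (𝒞 : CodeFamily) (ε : ℕ → ℝ),
    Tendsto ε atTop (𝓝 0) ∧ 𝒞.IsActive ρ ε ∧ 𝒞.achievedRate = R}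

/-- The capacity for a fixed error `ε`: the supremum of the rates that are achieved by families of
`(ρ, 1)`-active adversary wiretap II codes with error `ε`
(`0` if there is no such family). -/
def capacityAtError (ρ ε : ℝ) : ℝ :=
  sSup {R : ℝ | ∃ 𝒞 : CodeFamily, 𝒞.IsActive ρ (fun _ => ε) ∧ 𝒞.achievedRate = R}

end

end WtII

/-! Converse. Correct decoding makes the codeword sets of distinct messages disjoint. After `⌊n ρ⌋`
bits are read, at most `2 ^ (n - ⌊n ρ⌋)` words, hence at most as many messages, fit a given view.
Secrecy forces the view of every message to overlap that of a fixed one by `1 - ε`. Counting gives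
`k ≤ (1 - ρ) n + O(1)` for errors bounded away from `1` (`IsSecret.length_le`).

Achievability. Every word gets an independent uniform label in `Word k × Fin q`; the words labelled
`(m, 0)` encode `m`, and a nonzero second component means rejection. There are at most `2 ^ O(n 2 ^
(n ρ))` tampering functions, so a union bound works once the expected number `t = 2 ^ n / (2 ^ k q)`
of codewords per message exceeds `2 ^ (n ρ)` by a polynomial factor, which costs only `o(n)` message
bits (`exists_isBalanced`, `exists_isActiveCode`). A fixed event has nearly the same frequency among
the codewords of each message; for events on the bits read, this is secrecy. For a tampering
function `f`, either `f x = x`, or `f x` is one of few heavy words, and then all possible ways to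
decode these are covered by the union bound, or `f x` is light, and then it is rejected up to
frequency `O(n / q)`. The last claim involves the labels of both `x` and `f x`; fixing a bit that
`f` flips separates the two words and restores independence (`sum_exp_count_image_le`). The outcome
thus hardly depends on the message, and encoding a fixed message simulates it. -/

namespace WtII

open Filter Topology Finset

/-! ### Exponential moments of random labellings -/

section Labelling

variable {X Λ : Type*} [Fintype X] [DecidableEq X] [Fintype Λ]

/-- Labels of different points are independent, so the exponential moment factorises over the
points. -/
theorem sum_exp_sum_le [Nonempty Λ] (ψ : X → Λ → ℝ) (c : X → ℝ)
    (h : ∀ x, ∑ l, Real.exp (ψ x l) ≤ Fintype.card Λ * Real.exp (c x)) :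
    ∑ L : X → Λ, Real.exp (∑ x, ψ x (L x)) ≤
      Fintype.card (X → Λ) * Real.exp (∑ x, c x) := by
  have h1 : ∑ L : X → Λ, Real.exp (∑ x, ψ x (L x)) = ∏ x, ∑ l, Real.exp (ψ x l) := by
    rw [Finset.prod_univ_sum, Fintype.piFinset_univ]
    exact Finset.sum_congr rfl fun L _ => Real.exp_sum _ _
  rw [h1]
  calc ∏ x, ∑ l, Real.exp (ψ x l) ≤ ∏ x, (Fintype.card Λ * Real.exp (c x)) :=
        Finset.prod_le_prod (fun x _ => Finset.sum_nonneg fun l _ => (Real.exp_pos _).le)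
          fun x _ => h x
    _ = _ := by
        rw [Finset.prod_mul_distrib, Real.exp_sum]
        simp

theorem sum_exp_indicator_le [DecidableEq Λ] [Nonempty Λ] (s : Finset Λ) (θ : ℝ) :
    ∑ l, Real.exp (if l ∈ s then θ else 0) ≤
      Fintype.card Λ * Real.exp ((#s / Fintype.card Λ : ℝ) * (Real.exp θ - 1)) := by
  have hΛ : (0 : ℝ) < Fintype.card Λ := by exact_mod_cast Fintype.card_pos
  have h1 : ∑ l, Real.exp (if l ∈ s then θ else 0) =
      Fintype.card Λ * ((#s / Fintype.card Λ : ℝ) * (Real.exp θ - 1) + 1) := by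
    have : ∀ l, Real.exp (if l ∈ s then θ else 0) =
        (if l ∈ s then (Real.exp θ - 1) else 0) + 1 := by
      intro l; split_ifs <;> simp
    simp_rw [this, Finset.sum_add_distrib, Finset.sum_ite_mem, Finset.univ_inter]
    simp
    field_simp
  rw [h1]
  gcongr
  exact Real.add_one_le_exp _

/-- Exponential moment of a weighted count of the points whose label lies in `s`. -/
theorem sum_exp_weighted_count_le [DecidableEq Λ] [Nonempty Λ] (s : Finset Λ) (w : X → ℝ) :
    ∑ L : X → Λ, Real.exp (∑ x, if L x ∈ s then w x else 0) ≤
      Fintype.card (X → Λ) *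
        Real.exp (∑ x, (#s / Fintype.card Λ : ℝ) * (Real.exp (w x) - 1)) :=
  sum_exp_sum_le (fun x l => if l ∈ s then w x else 0) _
    fun x => sum_exp_indicator_le s (w x)

theorem exp_sub_one_le_two_mul {x : ℝ} (h0 : 0 ≤ x) (h1 : x ≤ 1) : Real.exp x - 1 ≤ 2 * x := by
  have := Real.abs_exp_sub_one_sub_id_le (x := x) (by rwa [abs_of_nonneg h0])
  have := (abs_le.1 this).2
  nlinarith

/-- Bernstein bound for the number of points of `A` that carry the label `l`. -/
theorem sum_exp_count_sub_le [DecidableEq Λ] [Nonempty Λ] (l : Λ) (A : Finset X) (θ : ℝ) (hθ : |θ| ≤ 1) :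
    ∑ L : X → Λ, Real.exp (θ * (#{x ∈ A | L x = l} - #A / Fintype.card Λ : ℝ)) ≤
      Fintype.card (X → Λ) * Real.exp (θ ^ 2 * (#A / Fintype.card Λ : ℝ)) := by
  have h1 := sum_exp_weighted_count_le (X := X) {l} (fun x => if x ∈ A then θ else 0)
  have h2 : ∀ L : X → Λ, (∑ x, if L x ∈ ({l} : Finset Λ) then (if x ∈ A then θ else 0) else 0) =
      θ * #{x ∈ A | L x = l} := by
    intro L
    rw [Finset.card_filter, Nat.cast_sum, Finset.mul_sum, ← Finset.sum_subset (Finset.subset_univ A)]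
    · exact Finset.sum_congr rfl fun x hx => by simp [hx]
    · intro x _ hx; simp [hx]
  have h3 : ∑ x : X, ((#({l} : Finset Λ) : ℝ) / Fintype.card Λ) *
      (Real.exp (if x ∈ A then θ else 0) - 1) = (#A / Fintype.card Λ : ℝ) * (Real.exp θ - 1) := by
    rw [← Finset.sum_subset (Finset.subset_univ A) (by intro x _ hx; simp [hx])]
    rw [Finset.sum_congr rfl (g := fun _ => (1 / Fintype.card Λ : ℝ) * (Real.exp θ - 1))
      (fun x hx => by simp [hx])]
    simp; ring
  simp_rw [h2, h3] at h1
  simp_rw [mul_sub, Real.exp_sub, ← Finset.sum_div]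
  rw [div_le_iff₀ (Real.exp_pos _), mul_assoc, ← Real.exp_add]
  refine h1.trans ?_
  gcongr
  have := (abs_le.1 (Real.abs_exp_sub_one_sub_id_le hθ)).2
  have hA : (0 : ℝ) ≤ #A / Fintype.card Λ := by positivity
  nlinarith

/-- Labels on `H` and off `H` can be drawn independently. -/
theorem sum_piecewise (H : Finset X) (F : (X → Λ) → ℝ) :
    ∑ L₂ : X → Λ, ∑ L₁ : X → Λ, F (H.piecewise L₁ L₂) =
      Fintype.card (X → Λ) * ∑ L, F L := by
  -- Two independent labellings exchange their values on `H`; this is a bijection on pairs.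
  have hinv : Function.Involutive (fun q : (X → Λ) × (X → Λ) =>
      (H.piecewise q.2 q.1, H.piecewise q.1 q.2)) := by
    rintro ⟨a, b⟩
    ext x <;> by_cases hx : x ∈ H <;> simp [hx]
  rw [← Fintype.sum_prod_type' (f := fun L₂ L₁ => F (H.piecewise L₁ L₂))]
  have := Equiv.sum_comp (hinv.toPerm) (fun q => F q.1)
  simp only [Function.Involutive.coe_toPerm] at this
  rw [this, Fintype.sum_prod_type]
  simp [Finset.mul_sum]

/-- Exponential moment of the number of points `x` of `A` with label `l` for which the label of
`f x` lies in `s`, when `A` and `f '' A` are separated and `f` has small fibres on `A`. -/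
theorem sum_exp_count_image_le [DecidableEq Λ] [Nonempty Λ] (l : Λ) (s : Finset Λ) (H A : Finset X) (f : X → X)
    (hA : A ⊆ H) (hf : ∀ x ∈ A, f x ∉ H) (θ : ℝ) (h0 : 0 ≤ θ) (h1 : θ ≤ 1)
    (hc : ∀ y, 2 * θ * #{x ∈ A | f x = y} ≤ Fintype.card Λ) :
    ∑ L : X → Λ, Real.exp (θ * #{x ∈ A | L x = l ∧ L (f x) ∈ s}) ≤
      Fintype.card (X → Λ) *
        Real.exp (4 * θ * (#s / Fintype.card Λ : ℝ) * (#A / Fintype.card Λ : ℝ)) := by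
  have hΛ : (0 : ℝ) < Fintype.card Λ := by exact_mod_cast Fintype.card_pos
  have hX : (0 : ℝ) < Fintype.card (X → Λ) := by exact_mod_cast Fintype.card_pos
  set e : ℝ := Real.exp θ - 1 with he
  have he0 : 0 ≤ e := by have := Real.add_one_le_exp θ; linarith
  have he2 : e ≤ 2 * θ := exp_sub_one_le_two_mul h0 h1
  refine le_of_mul_le_mul_left ?_ hX
  rw [← sum_piecewise H]
  -- With the labels off `H` frozen, the count is a sum of independent terms. Its moment bound,
  -- regrouped by the fibres of `f`, is a weighted count in `L₂`, to which the same estimate applies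
  -- again.
  have inner : ∀ L₂ : X → Λ,
      ∑ L₁ : X → Λ, Real.exp (θ * #{x ∈ A | H.piecewise L₁ L₂ x = l ∧
        H.piecewise L₁ L₂ (f x) ∈ s}) ≤ Fintype.card (X → Λ) *
        Real.exp (∑ y, if L₂ y ∈ s then e / Fintype.card Λ * #{x ∈ A | f x = y} else 0) := by
    intro L₂
    have h2 := sum_exp_weighted_count_le (X := X) {l}
      (fun x => if x ∈ A ∧ L₂ (f x) ∈ s then θ else 0)
    have h3 : ∀ L₁ : X → Λ, θ * #{x ∈ A | H.piecewise L₁ L₂ x = l ∧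
        H.piecewise L₁ L₂ (f x) ∈ s} = ∑ x, if L₁ x ∈ ({l} : Finset Λ) then
          (if x ∈ A ∧ L₂ (f x) ∈ s then θ else 0) else 0 := by
      intro L₁
      rw [Finset.card_filter, Nat.cast_sum, Finset.mul_sum,
        ← Finset.sum_subset (Finset.subset_univ A) (by intro x _ hx; simp [hx])]
      refine Finset.sum_congr rfl fun x hx => ?_
      rw [Finset.piecewise_eq_of_mem _ _ _ (hA hx), Finset.piecewise_eq_of_notMem _ _ _ (hf x hx)]
      by_cases a : L₁ x = l <;> by_cases b : L₂ (f x) ∈ s <;> simp [a, b, hx]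
    have h4 : ∑ x, ((#({l} : Finset Λ) : ℝ) / Fintype.card Λ) *
        (Real.exp (if x ∈ A ∧ L₂ (f x) ∈ s then θ else 0) - 1) =
        ∑ y, if L₂ y ∈ s then e / Fintype.card Λ * #{x ∈ A | f x = y} else 0 := by
      have h5 : ∀ y, (if L₂ y ∈ s then e / Fintype.card Λ * #{x ∈ A | f x = y} else 0) =
          ∑ x ∈ A with f x = y, if L₂ (f x) ∈ s then e / Fintype.card Λ else 0 := by
        intro y
        rw [Finset.sum_congr rfl (g := fun _ => if L₂ y ∈ s then e / Fintype.card Λ else 0)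
          (fun x hx => by rw [(Finset.mem_filter.1 hx).2])]
        split_ifs <;> simp [mul_comm]
      simp_rw [h5]
      rw [Finset.sum_fiberwise, ← Finset.sum_subset (Finset.subset_univ A)
        (by intro x _ hx; simp [hx])]
      refine Finset.sum_congr rfl fun x hx => ?_
      by_cases b : L₂ (f x) ∈ s <;> simp [b, hx, he]
      ring
    simp_rw [h3]
    rwa [h4] at h2
  refine (Finset.sum_le_sum fun L₂ _ => inner L₂).trans ?_
  rw [← Finset.mul_sum]
  refine mul_le_mul_of_nonneg_left ?_ hX.le
  refine (sum_exp_weighted_count_le s _).trans ?_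
  refine mul_le_mul_of_nonneg_left (Real.exp_le_exp.2 ?_) hX.le
  have hcard : ∑ y, (#{x ∈ A | f x = y} : ℝ) = #A := by
    rw [← Nat.cast_sum]
    exact_mod_cast (Finset.card_eq_sum_card_fiberwise (f := f) (s := A) (t := univ)
      (by simp [Set.MapsTo])).symm
  calc ∑ y, (#s / Fintype.card Λ : ℝ) *
        (Real.exp (e / Fintype.card Λ * #{x ∈ A | f x = y}) - 1)
      ≤ ∑ y, (#s / Fintype.card Λ : ℝ) *
        (2 * (2 * θ / Fintype.card Λ * #{x ∈ A | f x = y})) := by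
        refine Finset.sum_le_sum fun y _ => mul_le_mul_of_nonneg_left ?_ (by positivity)
        -- The fibre bound `hc` keeps the weights at most `1`, where `exp` is linearly bounded.
        have : e / Fintype.card Λ * #{x ∈ A | f x = y} ≤
            2 * θ / Fintype.card Λ * #{x ∈ A | f x = y} := by gcongr
        refine (exp_sub_one_le_two_mul (by positivity) (this.trans ?_)).trans (by linarith)
        rw [div_mul_eq_mul_div, div_le_one hΛ]
        exact hc y
    _ = _ := by
        rw [← Finset.mul_sum, ← Finset.mul_sum, ← Finset.mul_sum, hcard]
        ring

/-- The union bound, for events controlled by exponential moments. -/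
theorem exists_forall_neg_of_sum_exp_lt {Ω J J' : Type*} [Fintype Ω] [Fintype J] [Fintype J']
    [Nonempty Ω] (G : J → Ω → ℝ) (G' : J' → Ω → ℝ) (a a' : ℝ)
    (h : ∀ j, ∑ ω, Real.exp (G j ω) ≤ Fintype.card Ω * a)
    (h' : ∀ j, ∑ ω, Real.exp (G' j ω) ≤ Fintype.card Ω * a')
    (hlt : Fintype.card J * a + Fintype.card J' * a' < 1) :
    ∃ ω, (∀ j, G j ω < 0) ∧ ∀ j, G' j ω < 0 := by
  by_contra! hcon
  have hΩ : (0 : ℝ) < Fintype.card Ω := by exact_mod_cast Fintype.card_pos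
  -- Markov: a violated inequality contributes the exponential of a nonnegative number.
  have key : ∀ ω, 1 ≤ ∑ j, Real.exp (G j ω) + ∑ j, Real.exp (G' j ω) := by
    intro ω
    have p1 : 0 ≤ ∑ j, Real.exp (G j ω) := Finset.sum_nonneg fun _ _ => (Real.exp_pos _).le
    have p2 : 0 ≤ ∑ j, Real.exp (G' j ω) := Finset.sum_nonneg fun _ _ => (Real.exp_pos _).le
    by_cases hg : ∀ j, G j ω < 0
    · obtain ⟨j, hj⟩ := hcon ω hg
      have := Finset.single_le_sum (f := fun j => Real.exp (G' j ω))
        (fun _ _ => (Real.exp_pos _).le) (Finset.mem_univ j)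
      have := Real.one_le_exp hj
      linarith
    · push Not at hg
      obtain ⟨j, hj⟩ := hg
      have := Finset.single_le_sum (f := fun j => Real.exp (G j ω))
        (fun _ _ => (Real.exp_pos _).le) (Finset.mem_univ j)
      have := Real.one_le_exp hj
      linarith
  have h1 := Finset.sum_le_sum fun ω (_ : ω ∈ (univ : Finset Ω)) => key ω
  rw [Finset.sum_add_distrib, Finset.sum_comm, Finset.sum_comm (s := univ (α := Ω))] at h1
  have h2 := Finset.sum_le_sum fun j (_ : j ∈ (univ : Finset J)) => h j
  have h3 := Finset.sum_le_sum fun j (_ : j ∈ (univ : Finset J')) => h' j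
  simp only [Finset.sum_const, Finset.card_univ, nsmul_eq_mul, mul_one] at h1 h2 h3
  nlinarith

end Labelling

/-! ### Statistical distance -/

theorem PMF.sum_toReal_eq_one {α : Type*} [Fintype α] (p : PMF α) : ∑ a, (p a).toReal = 1 := by
  rw [← ENNReal.toReal_sum fun a _ => p.apply_ne_top a, ← tsum_fintype (L := .unconditional _), p.tsum_coe]
  rfl

/-- The statistical distance is the largest difference of the probabilities of an event. -/
theorem statDist_le_of_forall_sum_sub_le {α : Type} [Fintype α] (p q : PMF α) (γ : ℝ)
    (h : ∀ T : Finset α, ∑ a ∈ T, (p a).toReal - ∑ a ∈ T, (q a).toReal ≤ γ) :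
    statDist p q ≤ γ := by
  classical
  -- Both totals are `1`, so the excess of `p` on `T` equals that of `q` off `T`, and each is the
  -- distance.
  set T : Finset α := {a | (q a).toReal ≤ (p a).toReal}
  have h1 := PMF.sum_toReal_eq_one p
  have h2 := PMF.sum_toReal_eq_one q
  rw [← Finset.sum_add_sum_compl T] at h1 h2
  have h3 : ∑ a, |(p a).toReal - (q a).toReal| =
      ∑ a ∈ T, ((p a).toReal - (q a).toReal) + ∑ a ∈ Tᶜ, ((q a).toReal - (p a).toReal) := by
    rw [← Finset.sum_add_sum_compl T]
    congr 1
    · refine Finset.sum_congr rfl fun a ha => abs_of_nonneg ?_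
      have := (Finset.mem_filter.1 ha).2
      linarith
    · refine Finset.sum_congr rfl fun a ha => ?_
      have : ¬ (q a).toReal ≤ (p a).toReal := by simpa [T] using ha
      rw [abs_sub_comm]
      exact abs_of_nonneg (by linarith)
  have h4 := h T
  rw [Finset.sum_sub_distrib, Finset.sum_sub_distrib] at h3
  rw [statDist, h3]
  linarith

/-- The overlap form of the distance serves the converse, where overlaps are summed over all
messages. -/
theorem one_sub_statDist_eq_sum_min {α : Type} [Fintype α] (p q : PMF α) :
    1 - statDist p q = ∑ a, min (p a).toReal (q a).toReal := by
  have h1 := PMF.sum_toReal_eq_one p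
  have h2 := PMF.sum_toReal_eq_one q
  have h3 : ∀ a, min (p a).toReal (q a).toReal =
      (1 / 2) * ((p a).toReal + (q a).toReal - |(p a).toReal - (q a).toReal|) := by
    intro a
    rcases le_total (p a).toReal (q a).toReal with h | h
    · rw [min_eq_left h, abs_of_nonpos (by linarith)]; ring
    · rw [min_eq_right h, abs_of_nonneg (by linarith)]; ring
  simp_rw [h3, ← Finset.mul_sum, Finset.sum_sub_distrib, Finset.sum_add_distrib, h1, h2, statDist]
  ring

/-- The probability of an event under the image of a uniform distribution. -/
theorem sum_map_uniformOfFinset {α β : Type*} [DecidableEq α] [DecidableEq β] (s : Finset α)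
    (hs : s.Nonempty) (φ : α → β) (T : Finset β) :
    ∑ b ∈ T, (((PMF.uniformOfFinset s hs).map φ) b).toReal = #{x ∈ s | φ x ∈ T} / (#s : ℝ) := by
  have h1 : ∀ b, (((PMF.uniformOfFinset s hs).map φ) b).toReal =
      #{x ∈ s | φ x = b} / (#s : ℝ) := by
    intro b
    rw [PMF.map_apply, tsum_eq_sum (s := s)]
    · rw [Finset.sum_congr rfl (g := fun x => if φ x = b then (#s : ENNReal)⁻¹ else 0)
        (fun x hx => by simp [hx, eq_comm])]
      rw [← Finset.sum_filter]
      simp [div_eq_mul_inv]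
    · intro x hx
      simp [hx]
  simp_rw [h1, ← Finset.sum_div, ← Nat.cast_sum]
  rw [Finset.sum_card_fiberwise_eq_card_filter]

/-! ### Codes given by a labelling -/

section LabelCode

variable {k n : ℕ}

/-- The words that carry the label `(m, 0)`. -/
def codewords {q : ℕ} [NeZero q] (L : Word n → Word k × Fin q) (m : Word k) : Finset (Word n) :=
  {x | L x = (m, 0)}

/-- The encoder picks a uniform word with label `(m, 0)`; words with a label `(m, i)`, `i ≠ 0`,
are rejected. -/
noncomputable def labelCode {q : ℕ} [NeZero q] (L : Word n → Word k × Fin q)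
    (hL : ∀ m, (codewords L m).Nonempty) : CodingScheme k n where
  enc m := PMF.uniformOfFinset _ (hL m)
  dec x := if (L x).2 = 0 then some (L x).1 else none
  correct m := by
    have h := sum_map_uniformOfFinset _ (hL m)
      (fun x => if (L x).2 = 0 then some (L x).1 else none) {some m}
    rw [Finset.sum_singleton, Finset.filter_true_of_mem, div_self] at h
    · rw [← ENNReal.toReal_eq_one_iff]; exact h
    · have := (hL m).card_pos
      positivity
    · intro x hx
      have : L x = (m, 0) := by simpa [codewords] using hx
      simp [this]

/-- The tampering experiment in which an unchanged codeword yields `same*`. -/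
def strongOutcome (C : CodingScheme k n) (f : Word n → Word n) (x : Word n) : SimOutput k :=
  if f x = x then none else some (C.dec (f x))

/-- Encode a fixed message, query the tampering function, and decode unless nothing changed. -/
def strongSampler (k n : ℕ) : Sampler k n :=
  .callEnc (fun _ => false) fun x => .query x fun y =>
    if y = x then .output none else .callDec y fun o => .output (some o)

theorem strongSampler_cost_le : (strongSampler k n).cost ≤ 3 := by
  unfold strongSampler
  simp only [Sampler.cost]
  have : ∀ x y : Word n, (if y = x then (.output none : Sampler k n) else
      .callDec y fun o => .output (some o)).cost ≤ 1 := by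
    intro x y
    split_ifs <;> simp [Sampler.cost]
  have h2 : ∀ x : Word n, 1 + (univ.sup fun y => (if y = x then (.output none : Sampler k n) else
      .callDec y fun o => .output (some o)).cost) ≤ 2 := fun x => by
    have := Finset.sup_le (s := univ) fun y _ => this x y
    omega
  have := Finset.sup_le (s := univ) fun x _ => h2 x
  omega

theorem strongSampler_run (C : CodingScheme k n) (f : Word n → Word n) :
    (strongSampler k n).run C f = (C.enc fun _ => false).map (strongOutcome C f) := by
  unfold strongSampler
  simp only [Sampler.run, PMF.map]
  congr 1
  funext x
  unfold strongOutcome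
  simp only [Function.comp_apply]
  split_ifs <;> simp [Sampler.run]

theorem labelCode_isSecret {q : ℕ} [NeZero q] (L : Word n → Word k × Fin q)
    (hL : ∀ m, (codewords L m).Nonempty) (ρ ε : ℝ)
    (h : ∀ (m₀ m₁ : Word k) (S : Finset (Fin n)) (B : Finset (S → Bool)), (#S : ℝ) ≤ n * ρ →
      (#{x ∈ codewords L m₀ | restrict S x ∈ B} : ℝ) / #(codewords L m₀) -
        (#{x ∈ codewords L m₁ | restrict S x ∈ B} : ℝ) / #(codewords L m₁) ≤ ε) :
    IsSecret (labelCode L hL) ρ ε := by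
  intro m₀ m₁ S hS
  refine statDist_le_of_forall_sum_sub_le _ _ _ fun B => ?_
  simp only [labelCode]
  rw [sum_map_uniformOfFinset, sum_map_uniformOfFinset]
  exact h m₀ m₁ S B hS

theorem labelCode_isNonMalleable {q : ℕ} [NeZero q] (L : Word n → Word k × Fin q)
    (hL : ∀ m, (codewords L m).Nonempty) (F : Set (Word n → Word n)) (ε : ℝ)
    (h : ∀ (m₀ m₁ : Word k), ∀ f ∈ F, ∀ T : Finset (SimOutput k),
      (#{x ∈ codewords L m₀ | strongOutcome (labelCode L hL) f x ∈ T} : ℝ) / #(codewords L m₀) -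
        (#{x ∈ codewords L m₁ | strongOutcome (labelCode L hL) f x ∈ T} : ℝ) /
          #(codewords L m₁) ≤ ε) :
    IsNonMalleable (labelCode L hL) F ε 3 := by
  refine ⟨strongSampler k n, strongSampler_cost_le, fun f hf => ⟨_, rfl, fun m => ?_⟩⟩
  refine statDist_le_of_forall_sum_sub_le _ _ _ fun T => ?_
  rw [strongSampler_run, patch, PMF.map_comp, tamper]
  set C := labelCode L hL with hC
  have e0 : C.enc (fun _ => false) = PMF.uniformOfFinset _ (hL fun _ => false) := rfl
  have e1 : C.enc m = PMF.uniformOfFinset _ (hL m) := rfl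
  rw [e0, e1, sum_map_uniformOfFinset, sum_map_uniformOfFinset]
  -- The event is pulled back along patching. An unchanged codeword of `m` decodes to `m`, so on
  -- these codewords the patched strong outcome is the true one.
  refine le_trans (le_of_eq ?_) (h m (fun _ => false) f hf {y | y.getD (some m) ∈ T})
  congr 3
  · refine congrArg _ (Finset.filter_congr fun x hx => ?_)
    have hx : L x = (m, 0) := by simpa [codewords] using hx
    have : C.dec x = some m := by simp [hC, labelCode, hx]
    unfold strongOutcome
    split_ifs with hfx <;> simp [hfx, this]
  · simp

end LabelCode

/-! ### Counting tampering functions -/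

def BitFn.ofBits : Bool × Bool → BitFn
  | (false, false) => .set0
  | (false, true) => .set1
  | (true, false) => .keep
  | (true, true) => .flip

theorem BitFn.ofBits_surjective : Function.Surjective BitFn.ofBits := by
  rintro (_ | _ | _ | _)
  exacts [⟨(false, false), rfl⟩, ⟨(false, true), rfl⟩, ⟨(true, false), rfl⟩, ⟨(true, true), rfl⟩]

/-- The factor `4 ^ n` counts the pairs of subsets; with two bits per one-bit function there are at
most `4 ^ (n * 2 ^ d)` maps `g`. -/
theorem exists_finset_bitTampering (n d : ℕ) (ρ ρ' : ℝ)
    (hd : ∀ S : Finset (Fin n), (#S : ℝ) ≤ n * ρ → #S ≤ d) :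
    ∃ F : Finset (Word n → Word n), bitTampering n ρ ρ' ⊆ F ∧ #F ≤ 4 ^ n * 4 ^ (n * 2 ^ d) := by
  classical
  let F : Finset (Word n → Word n) :=
    ((univ : Finset (Finset (Fin n) × Finset (Fin n))).filter fun P => #P.1 ≤ d).biUnion fun P =>
      (univ : Finset ((P.1 → Bool) → (P.2 → Bool × Bool))).image fun g =>
        tamperFn P.1 P.2 fun z i => BitFn.ofBits (g z i)
  refine ⟨F, ?_, ?_⟩
  · rintro f ⟨Sr, Sw, g, hr, -, rfl⟩
    choose g' hg' using fun b => BitFn.ofBits_surjective b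
    simp only [F, coe_biUnion, Set.mem_iUnion, coe_image, Finset.coe_univ, Set.image_univ,
      Set.mem_range, Finset.coe_filter]
    refine ⟨(Sr, Sw), ⟨Finset.mem_univ _, hd Sr hr⟩, fun z i => g' (g z i), ?_⟩
    simp [hg']
  · refine (Finset.card_biUnion_le_card_mul _ _ (4 ^ (n * 2 ^ d)) fun P hP => ?_).trans ?_
    · refine Finset.card_image_le.trans ?_
      have hP : #P.1 ≤ d := (Finset.mem_filter.1 hP).2
      have hP2 : #P.2 ≤ n := by simpa using Finset.card_le_univ P.2
      simp only [Finset.card_univ, Fintype.card_fun, Fintype.card_prod, Fintype.card_bool,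
        Fintype.card_coe]
      rw [← pow_mul]
      exact Nat.pow_le_pow_right (by norm_num)
        (Nat.mul_le_mul hP2 (Nat.pow_le_pow_right (by norm_num) hP))
    · refine Nat.mul_le_mul_right _ ((Finset.card_filter_le _ _).trans ?_)
      simp [← mul_pow]

/-! ### The sets on which a random labelling has to be balanced -/

section Balanced

variable {n : ℕ}

/-- The words that are hit by more than a `1 / h` fraction of all words. -/
def heavy (h : ℕ) (f : Word n → Word n) : Finset (Word n) :=
  {y | 2 ^ n < h * #{x | f x = y}}

/-- The fibres over heavy words are disjoint and each fills more than a `1 / h` share of the cube.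
-/
theorem card_heavy_le (h : ℕ) (f : Word n → Word n) : #(heavy h f) ≤ h := by
  have h1 : ∑ y ∈ heavy h f, 2 ^ n ≤ ∑ y ∈ heavy h f, h * #{x | f x = y} :=
    Finset.sum_le_sum fun y hy => (Finset.mem_filter.1 hy).2.le
  rw [← Finset.mul_sum, Finset.sum_card_fiberwise_eq_card_filter, Finset.sum_const,
    smul_eq_mul] at h1
  have h2 : #{x | f x ∈ heavy h f} ≤ 2 ^ n := by
    simpa using Finset.card_le_univ (α := Word n) {x | f x ∈ heavy h f}
  exact Nat.le_of_mul_le_mul_right (h1.trans (Nat.mul_le_mul_left h h2)) (by positivity)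

/-- An event that depends only on whether `f` fixes `x`, and on `f x` if this is a heavy word. -/
def coarseEvent (h : ℕ) (f : Word n → Word n) (B : Finset (Word n)) (a b : Bool) :
    Finset (Word n) :=
  {x | if f x = x then a = true else if f x ∈ heavy h f then f x ∈ B else b = true}

/-- The events that the secrecy and the non-malleability of a labelling refer to. -/
def testSets (h : ℕ) (d : ℕ) (F : Finset (Word n → Word n)) : Finset (Finset (Word n)) :=
  (((univ : Finset (Finset (Fin n))).filter fun S => #S ≤ d).biUnion fun S =>
      (univ : Finset (Finset (S → Bool))).image fun B =>
        univ.filter fun x => restrict S x ∈ B) ∪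
    F.biUnion fun f => ((heavy h f).powerset ×ˢ (univ : Finset (Bool × Bool))).image fun P =>
      coarseEvent h f P.1 P.2.1 P.2.2

theorem card_testSets_le (h d : ℕ) (F : Finset (Word n → Word n)) :
    #(testSets h d F) ≤ 2 ^ n * 2 ^ 2 ^ d + #F * (2 ^ h * 4) := by
  refine (Finset.card_union_le _ _).trans (Nat.add_le_add ?_ ?_)
  · refine (Finset.card_biUnion_le_card_mul _ _ (2 ^ 2 ^ d) fun S hS => ?_).trans ?_
    · refine Finset.card_image_le.trans ?_
      simp only [Finset.card_univ, Fintype.card_finset, Fintype.card_fun, Fintype.card_bool,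
        Fintype.card_coe]
      exact Nat.pow_le_pow_right (by norm_num)
        (Nat.pow_le_pow_right (by norm_num) (Finset.mem_filter.1 hS).2)
    · exact Nat.mul_le_mul_right _ ((Finset.card_filter_le _ _).trans (by simp))
  · refine Finset.card_biUnion_le_card_mul _ _ _ fun f _ => Finset.card_image_le.trans ?_
    rw [Finset.card_product, Finset.card_powerset]
    refine Nat.mul_le_mul (Nat.pow_le_pow_right (by norm_num) (card_heavy_le h f)) (by simp)

theorem mem_testSets_of_restrict {h d : ℕ} {F : Finset (Word n → Word n)} {S : Finset (Fin n)}
    (hS : #S ≤ d) (B : Finset (S → Bool)) :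
    ({x | restrict S x ∈ B} : Finset (Word n)) ∈ testSets h d F := by
  refine Finset.mem_union_left _ (Finset.mem_biUnion.2 ⟨S, by simpa using hS, ?_⟩)
  exact Finset.mem_image_of_mem _ (Finset.mem_univ B)

theorem mem_testSets_of_coarseEvent {h d : ℕ} {F : Finset (Word n → Word n)}
    {f : Word n → Word n} (hf : f ∈ F) {B : Finset (Word n)} (hB : B ⊆ heavy h f) (a b : Bool) :
    coarseEvent h f B a b ∈ testSets h d F := by
  refine Finset.mem_union_right _ (Finset.mem_biUnion.2 ⟨f, hf, ?_⟩)
  exact Finset.mem_image.2 ⟨(B, a, b), by simpa using hB, rfl⟩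

theorem univ_mem_testSets (h d : ℕ) (F : Finset (Word n → Word n)) : univ ∈ testSets h d F := by
  have := mem_testSets_of_restrict (h := h) (d := d) (F := F) (S := ∅) (by simp) univ
  simpa only [Finset.mem_univ, Finset.filter_true] using this

/-- The words with `i`-th bit `b` to which `f` applies, flipping this bit, without
reaching a heavy word. -/
def flippedLight (h : ℕ) (f : Word n → Word n) (i : Fin n) (b : Bool) : Finset (Word n) :=
  {x | x i = b ∧ f x i ≠ b ∧ f x ∉ heavy h f}

/-- A labelling under which all test sets and all sets of codewords that are moved to light valid
words have about the expected size. -/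
structure IsBalanced {k q : ℕ} [NeZero q] (h d : ℕ) (F : Finset (Word n → Word n)) (η : ℝ)
    (L : Word n → Word k × Fin q) : Prop where
  abs_sub_lt : ∀ m, ∀ A ∈ testSets h d F,
    |(#{x ∈ A | L x = (m, 0)} : ℝ) - #A / (2 ^ k * q)| < η * (2 ^ n / (2 ^ k * q))
  flipped_lt : ∀ m, ∀ f ∈ F, ∀ i b,
    (#{x ∈ flippedLight h f i b | L x = (m, 0) ∧ (L (f x)).2 = 0} : ℝ) <
      8 / q * (2 ^ n / (2 ^ k * q))

/-- Union bound: the first exponential handles the test sets with both signs of the deviation, the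
second the sets `flippedLight`. The collections are fixed before the labelling is drawn. -/
theorem exists_isBalanced {k q : ℕ} [NeZero q] (h d : ℕ) (F : Finset (Word n → Word n)) (η : ℝ)
    (η0 : 0 < η) (η1 : η ≤ 1) (hh : (h : ℝ) ≤ 2 * (2 ^ n / (2 ^ k * q)))
    (hlt : (2 ^ k * 2 * (2 ^ n * 2 ^ 2 ^ d + #F * (2 ^ h * 4)) : ℝ) *
        Real.exp (-(η ^ 2 * (2 ^ n / (2 ^ k * q)) / 4)) +
      2 ^ k * #F * (n * 2) * Real.exp (-(2 * h / q)) < 1) :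
    ∃ L : Word n → Word k × Fin q, IsBalanced h d F η L := by
  set t : ℝ := 2 ^ n / (2 ^ k * q) with ht
  have hq : (0 : ℝ) < q := by exact_mod_cast Nat.pos_of_ne_zero (NeZero.ne q)
  have ht0 : 0 < t := by positivity
  have hcΛ : (Fintype.card (Word k × Fin q) : ℝ) = 2 ^ k * q := by simp
  have hle : ∀ A : Finset (Word n), (#A : ℝ) / (2 ^ k * q) ≤ t := by
    intro A
    rw [ht]
    gcongr
    exact_mod_cast (Finset.card_le_univ A).trans (by simp)
  -- The largest `θ` that fibres of size `2 ^ n / h` permit: `2 * θ * (2 ^ n / h) = 2 ^ k * q`, the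
  -- number of labels.
  set θ : ℝ := h / (2 * t) with hθ
  have hθ0 : 0 ≤ θ := by positivity
  have hθ1 : θ ≤ 1 := by rw [hθ, div_le_one (by positivity)]; exact hh
  -- `±η / 2` minimises the Bernstein exponent `σ ^ 2 * t - |σ| * η * t`, with value `-η ^ 2 * t /
  -- 4`.
  let σ : Bool → ℝ := fun s => if s then η / 2 else -(η / 2)
  have hσ2 : ∀ s, σ s ^ 2 = η ^ 2 / 4 := by intro s; simp only [σ]; split_ifs <;> ring
  have hσ1 : ∀ s, |σ s| ≤ 1 := by
    intro s; cases s <;> simp only [σ, Bool.false_eq_true, if_true, if_false, abs_neg] <;>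
      rw [abs_of_pos (by positivity)] <;> linarith
  let G : (Word k × Bool) × testSets h d F → (Word n → Word k × Fin q) → ℝ := fun j L =>
    σ j.1.2 * (#{x ∈ j.2.1 | L x = (j.1.1, 0)} - #j.2.1 / (2 ^ k * q)) - η / 2 * (η * t)
  let G' : (Word k × F) × Fin n × Bool → (Word n → Word k × Fin q) → ℝ := fun j L =>
    θ * #{x ∈ flippedLight h j.1.2.1 j.2.1 j.2.2 | L x = (j.1.1, 0) ∧
      L (j.1.2.1 x) ∈ (univ : Finset (Word k)) ×ˢ ({0} : Finset (Fin q))} - θ * (8 / q * t)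
  obtain ⟨L, h1, h2⟩ : ∃ L, (∀ j, G j L < 0) ∧ ∀ j, G' j L < 0 := by
    refine exists_forall_neg_of_sum_exp_lt G G' (Real.exp (-(η ^ 2 * t / 4)))
      (Real.exp (-(2 * h / q))) ?_ ?_ ?_
    · rintro ⟨⟨m, s⟩, A, hA⟩
      have p := sum_exp_count_sub_le (m, (0 : Fin q)) A (σ s) (hσ1 s)
      rw [hcΛ] at p
      simp only [G]
      simp_rw [Real.exp_sub, ← Finset.sum_div]
      rw [div_le_iff₀ (Real.exp_pos _), mul_assoc, ← Real.exp_add]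
      refine p.trans ?_
      gcongr
      rw [hσ2]
      have := hle A
      nlinarith [sq_nonneg η]
    · rintro ⟨⟨m, f, hf⟩, i, b⟩
      -- The half-cube `x i = b` contains the points, and their images lie in the opposite
      -- half-cube.
      have p := sum_exp_count_image_le (m, (0 : Fin q)) ((univ : Finset (Word k)) ×ˢ {0})
        ({x | x i = b} : Finset (Word n)) (flippedLight h f i b) f ?_ ?_ θ hθ0 hθ1 ?_
      · have hs : (#((univ : Finset (Word k)) ×ˢ ({0} : Finset (Fin q))) : ℝ) = 2 ^ k := by simp
        rw [hcΛ, hs] at p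
        simp only [G']
        simp_rw [Real.exp_sub, ← Finset.sum_div]
        rw [div_le_iff₀ (Real.exp_pos _), mul_assoc, ← Real.exp_add]
        refine p.trans ?_
        gcongr
        have e1 : (2 : ℝ) ^ k / (2 ^ k * q) = 1 / q := by field_simp
        have e2 : θ * (8 / q * t) = 4 * h / q := by rw [hθ]; field_simp; ring
        have e3 : 4 * θ * (1 / q) * t = 2 * h / q := by rw [hθ]; field_simp; ring
        rw [e1, e2]
        have : 4 * θ * (1 / q) * (#(flippedLight h f i b) / (2 ^ k * q)) ≤ 4 * θ * (1 / q) * t :=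
          mul_le_mul_of_nonneg_left (hle _) (by positivity)
        rw [e3] at this
        refine this.trans (le_of_eq ?_)
        ring
      · intro x hx
        have := (Finset.mem_filter.1 hx).2.1
        simpa using this
      · intro x hx
        have := (Finset.mem_filter.1 hx).2.2.1
        simpa using this
      · intro y
        rw [hcΛ]
        by_cases hy : y ∈ heavy h f
        · rw [Finset.filter_false_of_mem]
          · simp
          · rintro x hx rfl
            exact (Finset.mem_filter.1 hx).2.2.2 hy
        · have h3 : h * #{x | f x = y} ≤ 2 ^ n := by simpa [heavy] using hy
          have h4 : #{x ∈ flippedLight h f i b | f x = y} ≤ #{x | f x = y} :=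
            Finset.card_le_card (Finset.filter_subset_filter _ (Finset.subset_univ _))
          have h5 : (h * #{x ∈ flippedLight h f i b | f x = y} : ℝ) ≤ 2 ^ n := by
            exact_mod_cast (Nat.mul_le_mul_left h h4).trans h3
          have h6 : 2 * θ * (#{x ∈ flippedLight h f i b | f x = y} : ℝ) =
              (h * #{x ∈ flippedLight h f i b | f x = y} : ℝ) / t := by
            rw [hθ]; field_simp
          rw [h6, div_le_iff₀ ht0]
          refine h5.trans (le_of_eq ?_)
          rw [ht]; field_simp
    · refine lt_of_le_of_lt ?_ hlt
      have := card_testSets_le h d F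
      have : (#(testSets h d F) : ℝ) ≤ 2 ^ n * 2 ^ 2 ^ d + #F * (2 ^ h * 4) := by exact_mod_cast this
      simp only [Fintype.card_prod, Fintype.card_fun, Fintype.card_bool, Fintype.card_fin,
        Fintype.card_coe, Nat.cast_mul, Nat.cast_pow, Nat.cast_ofNat]
      gcongr
  refine ⟨L, fun m A hA => ?_, fun m f hf i b => ?_⟩
  · have p1 := h1 ((m, true), ⟨A, hA⟩)
    have p2 := h1 ((m, false), ⟨A, hA⟩)
    simp only [G, σ, if_true, Bool.false_eq_true, if_false] at p1 p2
    rw [abs_lt]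
    constructor
    · by_contra hcon
      have := mul_le_mul_of_nonneg_left (not_lt.1 hcon) (half_pos η0).le
      nlinarith
    · by_contra hcon
      have := mul_le_mul_of_nonneg_left (not_lt.1 hcon) (half_pos η0).le
      nlinarith
  · have p1 := h2 ((m, ⟨f, hf⟩), i, b)
    simp only [G', Finset.mem_product, Finset.mem_univ, true_and, Finset.mem_singleton] at p1
    by_contra hcon
    have := mul_le_mul_of_nonneg_left (not_lt.1 hcon) hθ0
    linarith

end Balanced

/-! ### Balanced labellings give active adversary wiretap II codes -/

namespace IsBalanced

variable {k n q : ℕ} [NeZero q] {h d : ℕ} {F : Finset (Word n → Word n)} {η : ℝ}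
  {L : Word n → Word k × Fin q}

theorem abs_card_codewords_sub_lt (hb : IsBalanced h d F η L) (m : Word k) :
    |(#(codewords L m) : ℝ) - 2 ^ n / (2 ^ k * q)| < η * (2 ^ n / (2 ^ k * q)) := by
  have := hb.abs_sub_lt m univ (univ_mem_testSets h d F)
  simpa [codewords] using this

theorem half_le_card_codewords (hb : IsBalanced h d F η L) (hη : η ≤ 1 / 2) (m : Word k) :
    (2 ^ n / (2 ^ k * q) : ℝ) / 2 ≤ #(codewords L m) := by
  have h1 := (abs_lt.1 (hb.abs_card_codewords_sub_lt m)).1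
  have hq : (0 : ℝ) < q := by exact_mod_cast Nat.pos_of_ne_zero (NeZero.ne q)
  have ht : (0 : ℝ) < 2 ^ n / (2 ^ k * q) := by positivity
  nlinarith

theorem codewords_nonempty (hb : IsBalanced h d F η L) (hη : η ≤ 1 / 2) (m : Word k) :
    (codewords L m).Nonempty := by
  have hq : (0 : ℝ) < q := by exact_mod_cast Nat.pos_of_ne_zero (NeZero.ne q)
  have ht : (0 : ℝ) < 2 ^ n / (2 ^ k * q) / 2 := by positivity
  rw [← Finset.card_pos]
  exact_mod_cast ht.trans_le (hb.half_le_card_codewords hη m)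

/-- Numerator and denominator each deviate by at most `η * t`, and the denominator is at least `t /
2`. -/
theorem abs_frequency_sub_le (hb : IsBalanced h d F η L) (hη : η ≤ 1 / 2) (m : Word k)
    {A : Finset (Word n)} (hA : A ∈ testSets h d F) :
    |(#{x ∈ codewords L m | x ∈ A} : ℝ) / #(codewords L m) - #A / 2 ^ n| ≤ 4 * η := by
  have hq : (0 : ℝ) < q := by exact_mod_cast Nat.pos_of_ne_zero (NeZero.ne q)
  have h1 := hb.abs_sub_lt m A hA
  have h2 := hb.abs_card_codewords_sub_lt m
  have h3 := hb.half_le_card_codewords hη m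
  have e1 : ({x ∈ codewords L m | x ∈ A} : Finset (Word n)) = {x ∈ A | L x = (m, 0)} := by
    ext x; simp [codewords, and_comm]
  rw [e1]
  set t : ℝ := 2 ^ n / (2 ^ k * q) with ht
  have ht0 : 0 < t := by positivity
  set a : ℝ := ((#{x ∈ A | L x = (m, 0)} : ℕ) : ℝ)
  set e : ℝ := ((#(codewords L m) : ℕ) : ℝ)
  set α : ℝ := #A / 2 ^ n with hα
  have hα0 : 0 ≤ α := by positivity
  have hα1 : α ≤ 1 := by
    rw [hα, div_le_one (by positivity)]
    exact_mod_cast (Finset.card_le_univ A).trans (by simp)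
  have e2 : (#A / (2 ^ k * q) : ℝ) = α * t := by rw [hα, ht]; field_simp
  rw [e2] at h1
  have he : 0 < e := by linarith
  have e3 : a / e - α = ((a - α * t) - α * (e - t)) / e := by field_simp; ring
  rw [e3, abs_div, abs_of_pos he, div_le_iff₀ he]
  have h4 : |α * (e - t)| ≤ η * t := by
    rw [abs_mul, abs_of_nonneg hα0]
    nlinarith [abs_nonneg (e - t)]
  have h5 := abs_sub (a - α * t) (α * (e - t))
  have hη0 : 0 < η := by
    have := (abs_nonneg _).trans_lt h2
    exact pos_of_mul_pos_left this ht0.le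
  nlinarith

/-- A moved word has a flipped bit, so `2 * n` sets `flippedLight` cover the case; division by `t /
2` turns `2 * n * (8 / q) * t` into `32 * n / q`. -/
theorem frequency_light_le (hb : IsBalanced h d F η L) (hη : η ≤ 1 / 2) (m : Word k)
    {f : Word n → Word n} (hf : f ∈ F) :
    (#{x ∈ codewords L m | f x ≠ x ∧ f x ∉ heavy h f ∧ (L (f x)).2 = 0} : ℝ) /
      #(codewords L m) ≤ 32 * n / q := by
  have hq : (0 : ℝ) < q := by exact_mod_cast Nat.pos_of_ne_zero (NeZero.ne q)
  have h3 := hb.half_le_card_codewords hη m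
  set t : ℝ := 2 ^ n / (2 ^ k * q) with ht
  have ht0 : 0 < t := by positivity
  have hsub : ({x ∈ codewords L m | f x ≠ x ∧ f x ∉ heavy h f ∧ (L (f x)).2 = 0} :
      Finset (Word n)) ⊆ (univ : Finset (Fin n × Bool)).biUnion fun P =>
        {x ∈ flippedLight h f P.1 P.2 | L x = (m, 0) ∧ (L (f x)).2 = 0} := by
    intro x hx
    obtain ⟨hx1, hx2, hx3, hx4⟩ := Finset.mem_filter.1 hx
    obtain ⟨i, hi⟩ := Function.ne_iff.1 hx2
    have hx1 : L x = (m, 0) := by simpa [codewords] using hx1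
    exact Finset.mem_biUnion.2 ⟨(i, x i), Finset.mem_univ _,
      by simp [flippedLight, hi, hx1, hx3, hx4]⟩
  have h4 : (#{x ∈ codewords L m | f x ≠ x ∧ f x ∉ heavy h f ∧ (L (f x)).2 = 0} : ℝ) ≤
      ∑ P : Fin n × Bool,
        (#{x ∈ flippedLight h f P.1 P.2 | L x = (m, 0) ∧ (L (f x)).2 = 0} : ℝ) := by
    exact_mod_cast (Finset.card_le_card hsub).trans Finset.card_biUnion_le
  have h5 := Finset.sum_le_sum fun (P : Fin n × Bool) (_ : P ∈ univ) =>
    (hb.flipped_lt m f hf P.1 P.2).le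
  rw [← ht, Finset.sum_const, nsmul_eq_mul] at h5
  simp only [Finset.card_univ, Fintype.card_prod, Fintype.card_fin, Fintype.card_bool,
    Nat.cast_mul, Nat.cast_ofNat] at h5
  rw [div_le_iff₀ (by linarith)]
  calc _ ≤ (n * 2 * (8 / q * t) : ℝ) := h4.trans h5
    _ = 32 * n / q * (t / 2) := by ring
    _ ≤ _ := by gcongr

/-- Replacing every light outcome by `⊥` turns the event into a coarse one. That event depends on
the labelling through the decoding of heavy words, which is why balance is required for all subsets
`B` of them. -/
theorem frequency_strongOutcome (hb : IsBalanced h d F η L) (hη : η ≤ 1 / 2)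
    {f : Word n → Word n} (hf : f ∈ F) (T : Finset (SimOutput k)) :
    ∃ α : ℝ, ∀ m, |(#{x ∈ codewords L m |
      strongOutcome (labelCode L (hb.codewords_nonempty hη)) f x ∈ T} : ℝ) /
        #(codewords L m) - α| ≤ 4 * η + 32 * n / q := by
  set C := labelCode L (hb.codewords_nonempty hη) with hC
  set A := coarseEvent h f {y ∈ heavy h f | some (C.dec y) ∈ T} (decide (none ∈ T))
    (decide (some none ∈ T)) with hA
  have hAt : A ∈ testSets h d F := mem_testSets_of_coarseEvent hf (Finset.filter_subset _ _) _ _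
  refine ⟨#A / 2 ^ n, fun m => ?_⟩
  have h1 := abs_le.1 (hb.abs_frequency_sub_le hη m hAt)
  have h2 := hb.frequency_light_le hη m hf
  set R : Finset (Word n) := {x ∈ codewords L m | f x ≠ x ∧ f x ∉ heavy h f ∧ (L (f x)).2 = 0}
  have key : ∀ x ∈ codewords L m, x ∉ R → (strongOutcome C f x ∈ T ↔ x ∈ A) := by
    intro x hx hxR
    have hxR : f x ≠ x → f x ∉ heavy h f → (L (f x)).2 ≠ 0 := by
      intro p1 p2 p3
      exact hxR (Finset.mem_filter.2 ⟨hx, p1, p2, p3⟩)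
    simp only [hA, coarseEvent, Finset.mem_filter, Finset.mem_univ, true_and, strongOutcome]
    split_ifs with p1 p2
    · simp
    · simp [p2]
    · have : C.dec (f x) = none := by simp [hC, labelCode, hxR p1 p2]
      simp [this]
  have c1 : #{x ∈ codewords L m | strongOutcome C f x ∈ T} ≤ #{x ∈ codewords L m | x ∈ A} + #R := by
    refine (Finset.card_le_card fun x hx => ?_).trans (Finset.card_union_le _ _)
    obtain ⟨hx1, hx2⟩ := Finset.mem_filter.1 hx
    by_cases hxR : x ∈ R
    · exact Finset.mem_union_right _ hxR
    · exact Finset.mem_union_left _ (Finset.mem_filter.2 ⟨hx1, (key x hx1 hxR).1 hx2⟩)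
  have c2 : #{x ∈ codewords L m | x ∈ A} ≤ #{x ∈ codewords L m | strongOutcome C f x ∈ T} + #R := by
    refine (Finset.card_le_card fun x hx => ?_).trans (Finset.card_union_le _ _)
    obtain ⟨hx1, hx2⟩ := Finset.mem_filter.1 hx
    by_cases hxR : x ∈ R
    · exact Finset.mem_union_right _ hxR
    · exact Finset.mem_union_left _ (Finset.mem_filter.2 ⟨hx1, (key x hx1 hxR).2 hx2⟩)
  have c1' : (#{x ∈ codewords L m | strongOutcome C f x ∈ T} : ℝ) / #(codewords L m) ≤
      #{x ∈ codewords L m | x ∈ A} / #(codewords L m) + #R / #(codewords L m) := by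
    rw [← add_div]
    gcongr
    exact_mod_cast c1
  have c2' : (#{x ∈ codewords L m | x ∈ A} : ℝ) / #(codewords L m) ≤
      #{x ∈ codewords L m | strongOutcome C f x ∈ T} / #(codewords L m) +
        #R / #(codewords L m) := by
    rw [← add_div]
    gcongr
    exact_mod_cast c2
  rw [abs_le]
  constructor <;> linarith [h1.1, h1.2]

/-- Two messages are compared through a common reference frequency, which doubles the error. -/
theorem isActiveCode (hb : IsBalanced h d F η L) (hη : η ≤ 1 / 2) (ρ : ℝ)
    (hd : ∀ S : Finset (Fin n), (#S : ℝ) ≤ n * ρ → #S ≤ d) (hF : bitTampering n ρ 1 ⊆ F) :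
    IsActiveCode (labelCode L (hb.codewords_nonempty hη)) ρ (8 * η + 64 * n / q) 3 := by
  constructor
  · refine labelCode_isSecret _ _ _ _ fun m₀ m₁ S B hS => ?_
    have hA := mem_testSets_of_restrict (h := h) (F := F) (hd S hS) B
    have h0 := abs_le.1 (hb.abs_frequency_sub_le hη m₀ hA)
    have h1 := abs_le.1 (hb.abs_frequency_sub_le hη m₁ hA)
    simp only [Finset.mem_filter, Finset.mem_univ, true_and] at h0 h1
    have : (0 : ℝ) ≤ 64 * n / q := by positivity
    linarith [h0.1, h0.2, h1.1, h1.2]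
  · refine labelCode_isNonMalleable _ _ _ _ fun m₀ m₁ f hf T => ?_
    obtain ⟨α, hα⟩ := hb.frequency_strongOutcome hη (hF hf) T
    have h0 := abs_le.1 (hα m₀)
    have h1 := abs_le.1 (hα m₁)
    have : (64 * n / q : ℝ) = 2 * (32 * n / q) := by ring
    linarith [h0.2, h1.1]

end IsBalanced

/-! ### Existence of codes at every rate below capacity -/

/-- A slack of `√n` bits absorbs every polynomial factor and is negligible for the rate. -/
theorem eventually_mul_pow_le_two_rpow_sqrt (c : ℝ) (j : ℕ) :
    ∀ᶠ n : ℕ in atTop, c * (n : ℝ) ^ j ≤ (2 : ℝ) ^ √(n : ℝ) := by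
  have h1 : Tendsto (fun x : ℝ => c * (x ^ ((2 * j : ℕ) : ℝ) * Real.exp (-Real.log 2 * x))) atTop
      (𝓝 (c * 0)) :=
    (tendsto_rpow_mul_exp_neg_mul_atTop_nhds_zero _ _ (Real.log_pos one_lt_two)).const_mul c
  rw [mul_zero] at h1
  have h2 : Tendsto (fun n : ℕ => √(n : ℝ)) atTop atTop :=
    Real.tendsto_sqrt_atTop.comp tendsto_natCast_atTop_atTop
  filter_upwards [(h1.comp h2).eventually_le_const one_pos] with n hn
  simp only [Function.comp_apply, Real.rpow_natCast] at hn
  rw [pow_mul, Real.sq_sqrt (Nat.cast_nonneg n), neg_mul, Real.exp_neg, ← mul_assoc,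
    ← div_eq_mul_inv, div_le_one (Real.exp_pos _)] at hn
  rwa [Real.rpow_def_of_pos two_pos]

theorem two_pow_le_exp (a : ℕ) : (2 : ℝ) ^ a ≤ Real.exp a := by
  rw [← Real.exp_one_pow]
  gcongr
  exact Real.exp_one_gt_two.le

theorem exists_isActiveCode (ρ : ℝ) (h0 : 0 ≤ ρ) :
    ∃ n₀ : ℕ, ∀ n ≥ n₀, ∀ k : ℕ, (k + √n : ℝ) ≤ (1 - ρ) * n →
      ∃ C : CodingScheme k n, IsActiveCode C ρ (72 / n) 3 := by
  obtain ⟨n₁, hn₁⟩ := eventually_atTop.1 (eventually_mul_pow_le_two_rpow_sqrt 72 7)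
  refine ⟨max n₁ 2, fun n hn k hk => ?_⟩
  have hn2 : 2 ≤ n := (le_max_right _ _).trans hn
  have hexp := hn₁ n ((le_max_left _ _).trans hn)
  have hn2' : (2 : ℝ) ≤ n := by exact_mod_cast hn2
  have hnpos : (0 : ℝ) < n := by linarith
  set d := ⌊n * ρ⌋₊ with hd
  -- Up to a constant factor, `Q` bounds the logarithm of the number of tampering functions. With `q
  -- = n ^ 2` and `η = 1 / n`, the choice of `h` gives `2 * h / q = 16 * Q`, and `t ≥ 72 * n ^ 4 *
  -- Q` gives `η ^ 2 * t / 4 ≥ 18 * n ^ 2 * Q`; both beat the logarithms `7 * Q` and `17 * n ^ 2 *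
  -- Q` of the counts. The bound on `t` needs `72 * n ^ 7 ≤ 2 ^ √n`.
  set D : ℕ := 2 ^ d with hD
  set Q : ℕ := n * D with hQ
  set h : ℕ := 8 * n ^ 2 * Q with hh
  have hD1 : 1 ≤ D := Nat.one_le_two_pow
  have hnQ : n ≤ Q := Nat.le_mul_of_pos_right _ hD1
  have hDQ : D ≤ Q := Nat.le_mul_of_pos_left _ (by omega)
  have : NeZero (n ^ 2) := ⟨by positivity⟩
  have hdS : ∀ S : Finset (Fin n), (#S : ℝ) ≤ n * ρ → #S ≤ d := fun S hS => Nat.le_floor hS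
  obtain ⟨F, hF, hFc⟩ := exists_finset_bitTampering n d ρ 1 hdS
  have hkn : k ≤ n := by
    have : (k : ℝ) ≤ n := by nlinarith [Real.sqrt_nonneg (n : ℝ)]
    exact_mod_cast this
  set t : ℝ := 2 ^ n / (2 ^ k * ((n ^ 2 : ℕ) : ℝ)) with ht
  have hDle : (D : ℝ) ≤ 2 ^ (n * ρ : ℝ) := by
    rw [hD, Nat.cast_pow, ← Real.rpow_natCast]
    exact Real.rpow_le_rpow_of_exponent_le one_le_two (Nat.floor_le (by positivity))
  have hpow : (2 : ℝ) ^ k * (2 ^ √(n : ℝ) * 2 ^ (n * ρ : ℝ)) ≤ 2 ^ n := by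
    rw [← Real.rpow_natCast, ← Real.rpow_natCast, ← Real.rpow_add two_pos,
      ← Real.rpow_add two_pos]
    exact Real.rpow_le_rpow_of_exponent_le one_le_two (by linarith)
  have htQ : (72 * n ^ 4 * Q : ℝ) ≤ t := by
    rw [ht, le_div_iff₀ (by positivity)]
    refine le_trans ?_ hpow
    rw [hQ]
    push_cast
    calc (72 * n ^ 4 * (n * D) * (2 ^ k * n ^ 2) : ℝ) = 2 ^ k * (72 * n ^ 7 * D) := by ring
      _ ≤ 2 ^ k * (2 ^ √(n : ℝ) * 2 ^ (n * ρ : ℝ)) := by gcongr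
  have hQpos : (2 : ℝ) ≤ Q := by exact_mod_cast hn2.trans hnQ
  have hF4 : #F ≤ 2 ^ (4 * Q) := by
    refine hFc.trans ?_
    rw [← pow_add, show 4 = 2 ^ 2 from rfl, ← pow_mul]
    exact Nat.pow_le_pow_right (by norm_num) (by rw [← hD, ← hQ]; omega)
  have hη2 : (1 / n : ℝ) ≤ 1 / 2 := one_div_le_one_div_of_le two_pos hn2'
  -- Each of the two terms of the union bound is at most `1 / e < 1 / 2`.
  have half : ∀ a : ℕ, ∀ x y : ℝ, x ≤ 2 ^ a → a + 1 ≤ y → x * Real.exp (-y) < 1 / 2 := by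
    intro a x y hx hy
    calc x * Real.exp (-y) ≤ Real.exp a * Real.exp (-(a + 1)) := by
          have := hx.trans (two_pow_le_exp a)
          gcongr
      _ = (Real.exp 1)⁻¹ := by rw [← Real.exp_add, ← Real.exp_neg]; ring_nf
      _ < 1 / 2 := by
        rw [one_div]
        exact inv_strictAnti₀ two_pos Real.exp_one_gt_two
  obtain ⟨L, hL⟩ := exists_isBalanced (k := k) (q := n ^ 2) h d F (1 / n) (by positivity)
    (by linarith) (by
      rw [← ht, hh]
      push_cast
      have : (n : ℝ) ^ 2 * 1 ≤ n ^ 2 * n ^ 2 := by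
        gcongr
        nlinarith
      nlinarith) (by
      rw [← ht]
      have b1 : 2 ^ k * 2 * (2 ^ n * 2 ^ 2 ^ d + #F * (2 ^ h * 4)) ≤ 2 ^ (17 * n ^ 2 * Q) := by
        have c1 : 2 ^ n * 2 ^ 2 ^ d ≤ 2 ^ (4 * Q + h + 2) := by
          rw [← hD, ← pow_add]
          exact Nat.pow_le_pow_right (by norm_num) (by omega)
        have c2 : #F * (2 ^ h * 4) ≤ 2 ^ (4 * Q + h + 2) := by
          calc #F * (2 ^ h * 4) ≤ 2 ^ (4 * Q) * (2 ^ h * 4) := Nat.mul_le_mul_right _ hF4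
            _ = _ := by ring
        have c3 : 2 ^ k * 2 ≤ 2 ^ (Q + 1) := by
          rw [pow_succ]
          exact Nat.mul_le_mul_right _ (Nat.pow_le_pow_right (by norm_num) (hkn.trans hnQ))
        calc _ ≤ 2 ^ (Q + 1) * (2 ^ (4 * Q + h + 2) + 2 ^ (4 * Q + h + 2)) :=
              Nat.mul_le_mul c3 (Nat.add_le_add c1 c2)
          _ = 2 ^ (5 * Q + h + 4) := by ring
          _ ≤ _ := by
            refine Nat.pow_le_pow_right (by norm_num) ?_
            have : Q ≤ n ^ 2 * Q := Nat.le_mul_of_pos_left _ (by positivity)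
            have : 2 ≤ Q := hn2.trans hnQ
            rw [hh]
            nlinarith
      have b2 : 2 ^ k * #F * (n * 2) ≤ 2 ^ (7 * Q) := by
        have c1 : n * 2 ≤ 2 ^ (Q + 1) := by
          rw [pow_succ]
          exact Nat.mul_le_mul_right _ (hnQ.trans Nat.lt_two_pow_self.le)
        calc _ ≤ 2 ^ Q * 2 ^ (4 * Q) * 2 ^ (Q + 1) :=
              Nat.mul_le_mul (Nat.mul_le_mul
                (Nat.pow_le_pow_right (by norm_num) (hkn.trans hnQ)) hF4) c1
          _ = 2 ^ (6 * Q + 1) := by ring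
          _ ≤ _ := Nat.pow_le_pow_right (by norm_num) (by omega)
      have a1 := half (17 * n ^ 2 * Q) (2 ^ k * 2 * (2 ^ n * 2 ^ 2 ^ d + #F * (2 ^ h * 4)))
        ((1 / n : ℝ) ^ 2 * t / 4) (by exact_mod_cast b1) (by
          have : (1 / n : ℝ) ^ 2 * (72 * n ^ 4 * Q) / 4 ≤ (1 / n : ℝ) ^ 2 * t / 4 := by gcongr
          have e : (1 / n : ℝ) ^ 2 * (72 * n ^ 4 * Q) / 4 = 18 * n ^ 2 * Q := by
            field_simp; norm_num
          push_cast
          nlinarith)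
      have a2 := half (7 * Q) (2 ^ k * #F * (n * 2)) (2 * h / (n ^ 2 : ℕ))
        (by exact_mod_cast b2) (by
          have e : (2 * h / (n ^ 2 : ℕ) : ℝ) = 16 * Q := by
            rw [hh]; push_cast; field_simp; norm_num
          rw [e]
          push_cast
          linarith)
      linarith)
  have hfin := hL.isActiveCode hη2 ρ hdS hF
  have e : (8 * (1 / n) + 64 * n / (n ^ 2 : ℕ) : ℝ) = 72 / n := by
    push_cast; field_simp; norm_num
  rw [e] at hfin
  exact ⟨_, hfin⟩

/-! ### The upper bound -/

section UpperBound

variable {k n : ℕ}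

theorem CodingScheme.dec_of_mem_support (C : CodingScheme k n) {m : Word k} {x : Word n}
    (hx : x ∈ (C.enc m).support) : C.dec x = some m := by
  have h := (PMF.apply_eq_one_iff _ _).1 (C.correct m)
  rw [PMF.support_map] at h
  have : C.dec x ∈ C.dec '' (C.enc m).support := ⟨x, hx, rfl⟩
  rwa [h] at this

theorem CodingScheme.length_le (C : CodingScheme k n) : k ≤ n := by
  choose x hx using fun m => (C.enc m).support_nonempty
  have hinj : Function.Injective x := fun m m' h => by
    have h1 := C.dec_of_mem_support (hx m)
    rw [h, C.dec_of_mem_support (hx m')] at h1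
    exact (Option.some_injective _ h1).symm
  have := Fintype.card_le_of_injective x hinj
  simp only [Fintype.card_fun, Fintype.card_bool, Fintype.card_fin] at this
  exact (Nat.pow_le_pow_iff_right (by norm_num)).1 this

theorem card_restrict_fiber_le (S : Finset (Fin n)) (z : S → Bool) :
    #{x : Word n | restrict S x = z} ≤ 2 ^ (n - #S) := by
  classical
  calc #{x : Word n | restrict S x = z}
      ≤ #(univ : Finset ((Sᶜ : Finset (Fin n)) → Bool)) := by
        refine Finset.card_le_card_of_injOn (restrict Sᶜ) (fun _ _ => Finset.mem_univ _) ?_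
        intro x hx y hy hxy
        have hx : restrict S x = z := by simpa using hx
        have hy : restrict S y = z := by simpa using hy
        funext i
        by_cases hi : i ∈ S
        · exact congrFun (hx.trans hy.symm) ⟨i, hi⟩
        · exact congrFun hxy ⟨i, by simpa using hi⟩
    _ = 2 ^ (n - #S) := by simp

theorem IsSecret.two_pow_mul_le {C : CodingScheme k n} {ρ ε : ℝ} (h : IsSecret C ρ ε)
    (S : Finset (Fin n)) (hS : (#S : ℝ) ≤ n * ρ) : (1 - ε) * 2 ^ k ≤ (2 : ℝ) ^ (n - #S) := by
  classical
  let P : Word k → PMF (S → Bool) := fun m => (C.enc m).map (restrict S)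
  let m₀ : Word k := fun _ => false
  have h1 : ∀ m, 1 - ε ≤ ∑ z, min (P m z).toReal (P m₀ z).toReal := fun m => by
    rw [← one_sub_statDist_eq_sum_min]
    linarith [h m m₀ S hS]
  have h2 := Finset.sum_le_sum fun m (_ : m ∈ (univ : Finset (Word k))) => h1 m
  rw [Finset.sum_comm, Finset.sum_const, nsmul_eq_mul] at h2
  have h3 : ∀ z, ∑ m, min (P m z).toReal (P m₀ z).toReal ≤
      (2 : ℝ) ^ (n - #S) * (P m₀ z).toReal := by
    intro z
    -- Each message compatible with the view `z` owns a codeword in the fibre of `z`, and no two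
    -- share one.
    have hc : #{m | P m z ≠ 0} ≤ 2 ^ (n - #S) := by
      refine le_trans ?_ (card_restrict_fiber_le S z)
      have hex : ∀ m, P m z ≠ 0 → ∃ x ∈ (C.enc m).support, restrict S x = z := fun m hm => by
        have : z ∈ (P m).support := (PMF.mem_support_iff _ _).2 hm
        rw [PMF.support_map] at this
        exact this
      choose! x hx hxz using hex
      refine Finset.card_le_card_of_injOn x (fun m hm => ?_) fun m hm m' hm' hmm => ?_
      · simpa using hxz m (by simpa using hm)
      · have e1 := C.dec_of_mem_support (hx m (by simpa using hm))
        rw [hmm, C.dec_of_mem_support (hx m' (by simpa using hm'))] at e1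
        exact (Option.some_injective _ e1).symm
    calc ∑ m, min (P m z).toReal (P m₀ z).toReal
        ≤ ∑ m, if P m z ≠ 0 then (P m₀ z).toReal else 0 := by
          refine Finset.sum_le_sum fun m _ => ?_
          split_ifs with hm
          · exact min_le_right _ _
          · have : P m z = 0 := not_not.1 hm
            simp [this]
      _ = #{m | P m z ≠ 0} * (P m₀ z).toReal := by
          rw [← Finset.sum_filter, Finset.sum_const, nsmul_eq_mul]
      _ ≤ _ := by
          gcongr
          exact_mod_cast hc
  have h4 := h2.trans (Finset.sum_le_sum fun z _ => h3 z)
  rw [← Finset.mul_sum, PMF.sum_toReal_eq_one] at h4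
  simp only [Finset.card_univ, Fintype.card_fun, Fintype.card_bool, Fintype.card_fin,
    Nat.cast_pow, Nat.cast_ofNat, mul_one] at h4
  linarith

/-- The finite-length bound on the message length of a secret code. -/
theorem IsSecret.length_le {C : CodingScheme k n} {ρ ε : ℝ} (h : IsSecret C ρ ε) (h0 : 0 ≤ ρ)
    (h1 : ρ ≤ 1) (hε : ε < 1) :
    (k : ℝ) ≤ (1 - ρ) * n + (1 - Real.logb 2 (1 - ε)) := by
  have hfl : ⌊n * ρ⌋₊ ≤ n := Nat.floor_le_of_le (by nlinarith [Nat.cast_nonneg (α := ℝ) n])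
  obtain ⟨S, -, hS⟩ := Finset.exists_subset_card_eq (s := (univ : Finset (Fin n)))
    (n := ⌊n * ρ⌋₊) (by simpa using hfl)
  have h2 := h.two_pow_mul_le S (by rw [hS]; exact Nat.floor_le (by positivity))
  have hpos : 0 < 1 - ε := by linarith
  have h3 := Real.logb_le_logb_of_le one_lt_two (by positivity) h2
  rw [Real.logb_mul hpos.ne' (by positivity), Real.logb_pow, Real.logb_pow,
    Real.logb_self_eq_one one_lt_two, hS, Nat.cast_sub hfl] at h3
  -- Rounding `n * ρ` down costs at most one bit, the `1` in the bound.
  have := Nat.lt_floor_add_one (n * ρ : ℝ)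
  linarith

end UpperBound

namespace CodeFamily

theorem le_len (𝒞 : CodeFamily) (k : ℕ) : k ≤ 𝒞.len k := (𝒞.code k).length_le

theorem tendsto_len (𝒞 : CodeFamily) : Tendsto 𝒞.len atTop atTop :=
  tendsto_atTop_mono 𝒞.le_len tendsto_id

theorem rate_nonneg (𝒞 : CodeFamily) (k : ℕ) : 0 ≤ 𝒞.rate k := by
  unfold rate; positivity

theorem rate_le_one (𝒞 : CodeFamily) (k : ℕ) : 𝒞.rate k ≤ 1 :=
  div_le_one_of_le₀ (by exact_mod_cast 𝒞.le_len k) (by positivity)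

/-- On `ℝ`, comparisons of `limsup` need boundedness, since an unbounded one has a default value. -/
theorem isBoundedUnder_le_rate (𝒞 : CodeFamily) : IsBoundedUnder (· ≤ ·) atTop 𝒞.rate :=
  isBoundedUnder_of ⟨1, 𝒞.rate_le_one⟩

theorem isCoboundedUnder_le_rate (𝒞 : CodeFamily) : IsCoboundedUnder (· ≤ ·) atTop 𝒞.rate :=
  (isBoundedUnder_of ⟨0, 𝒞.rate_nonneg⟩ : IsBoundedUnder (· ≥ ·) atTop 𝒞.rate).isCoboundedUnder_le

theorem achievedRate_nonneg (𝒞 : CodeFamily) : 0 ≤ 𝒞.achievedRate :=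
  le_limsup_of_frequently_le (Eventually.frequently (Eventually.of_forall 𝒞.rate_nonneg))
    𝒞.isBoundedUnder_le_rate

/-- The converse bound: the errors only have to stay away from `1`. -/
theorem IsActive.achievedRate_le {𝒞 : CodeFamily} {ρ : ℝ} {ε : ℕ → ℝ} (h : 𝒞.IsActive ρ ε)
    (h0 : 0 ≤ ρ) (h1 : ρ ≤ 1) {e : ℝ} (he : e < 1) (hε : ∀ᶠ k in atTop, ε k ≤ e) :
    𝒞.achievedRate ≤ 1 - ρ := by
  obtain ⟨p, hp⟩ := h
  set c := 1 - Real.logb 2 (1 - e)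
  have hlim : Tendsto (fun k => (1 - ρ) + c / (𝒞.len k : ℝ)) atTop (𝓝 (1 - ρ)) := by
    simpa using ((tendsto_const_div_atTop_nhds_zero_nat c).comp 𝒞.tendsto_len).const_add (1 - ρ)
  rw [← hlim.limsup_eq]
  refine limsup_le_limsup ?_ 𝒞.isCoboundedUnder_le_rate hlim.isBoundedUnder_le
  filter_upwards [hε, eventually_gt_atTop 0] with k hk hk0
  have hs : IsSecret (𝒞.code k) ρ e := fun m₀ m₁ S hS => ((hp k).1 m₀ m₁ S hS).trans hk
  have hn : (0 : ℝ) < 𝒞.len k := by exact_mod_cast hk0.trans_le (𝒞.le_len k)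
  have := hs.length_le h0 h1 he
  rw [rate, div_le_iff₀ hn, add_mul, div_mul_cancel₀ _ hn.ne']
  exact this

end CodeFamily

theorem IsActiveCode.mono {k n : ℕ} {C : CodingScheme k n} {ρ ε ε' : ℝ} {t : ℕ}
    (h : IsActiveCode C ρ ε t) (hε : ε ≤ ε') : IsActiveCode C ρ ε' t := by
  refine ⟨fun m₀ m₁ S hS => (h.1 m₀ m₁ S hS).trans hε, ?_⟩
  obtain ⟨A, hA, hf⟩ := h.2
  refine ⟨A, hA, fun f hF => ?_⟩
  obtain ⟨D, hD, hm⟩ := hf f hF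
  exact ⟨D, hD, fun m => (hm m).trans hε⟩

/-! ### Families that achieve capacity -/

/-- Each `k` gets the least admissible length. The bound `e` on every error is for the fixed-error
capacity, which constrains short messages too. -/
theorem exists_capacity_achieving_family (ρ : ℝ) (h0 : 0 ≤ ρ) (h1 : ρ < 1) (e : ℝ) (he : 0 < e) :
    ∃ (𝒞 : CodeFamily) (ε : ℕ → ℝ), (∀ k, ε k ≤ e) ∧ Tendsto ε atTop (𝓝 0) ∧ 𝒞.IsActive ρ ε ∧
      Tendsto 𝒞.rate atTop (𝓝 (1 - ρ)) := by
  obtain ⟨n₀, hn₀⟩ := exists_isActiveCode ρ h0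
  have hinv : Tendsto (fun n : ℕ => 72 / (n : ℝ)) atTop (𝓝 0) :=
    tendsto_const_div_atTop_nhds_zero_nat 72
  have hsqrt : Tendsto (fun n : ℕ => √(n : ℝ) / n) atTop (𝓝 0) := by
    have h2 : Tendsto (fun n : ℕ => √(n : ℝ)) atTop atTop :=
      Real.tendsto_sqrt_atTop.comp tendsto_natCast_atTop_atTop
    simpa [Function.comp_def, Real.sqrt_div_self] using tendsto_inv_atTop_zero.comp h2
  obtain ⟨N, hN⟩ := eventually_atTop.1
    ((hinv.eventually_le_const he).and (eventually_ge_atTop (max n₀ 1)))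
  have hex : ∀ k : ℕ, ∃ n, N ≤ n ∧ (k + √n : ℝ) ≤ (1 - ρ) * n := by
    intro k
    have h3 : Tendsto (fun n : ℕ => k / (n : ℝ) + √(n : ℝ) / n) atTop (𝓝 0) := by
      simpa using (tendsto_const_div_atTop_nhds_zero_nat (k : ℝ)).add hsqrt
    obtain ⟨n, hn1, hn2, hn3⟩ := ((h3.eventually_le_const (sub_pos.2 h1)).and
      ((eventually_ge_atTop N).and (eventually_gt_atTop 0))).exists
    refine ⟨n, hn2, ?_⟩
    rwa [← add_div, div_le_iff₀ (by exact_mod_cast hn3)] at hn1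
  classical
  let len : ℕ → ℕ := fun k => Nat.find (hex k)
  have hlen : ∀ k, N ≤ len k ∧ (k + √(len k) : ℝ) ≤ (1 - ρ) * len k := fun k =>
    Nat.find_spec (hex k)
  have hmin : ∀ k n, N ≤ n → n < len k → (1 - ρ) * n < (k + √n : ℝ) := fun k n hn hlt =>
    not_le.1 fun hcon => Nat.find_min (hex k) hlt ⟨hn, hcon⟩
  choose code hcode using fun k =>
    hn₀ (len k) ((le_max_left _ _).trans (hN (len k) (hlen k).1).2) k (hlen k).2
  let 𝒞 : CodeFamily := ⟨len, code⟩
  have hpos : ∀ k, (1 : ℝ) ≤ len k := fun k => by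
    exact_mod_cast (le_max_right _ _).trans (hN (len k) (hlen k).1).2
  refine ⟨𝒞, fun k => 72 / (len k : ℝ), fun k => (hN (len k) (hlen k).1).1,
    hinv.comp 𝒞.tendsto_len, ⟨Polynomial.C 3, fun k => ?_⟩, ?_⟩
  · simpa using hcode k
  · have hlow : Tendsto (fun n : ℕ => (1 - ρ) - (1 - ρ) / (n : ℝ) - √(n : ℝ) / n) atTop
        (𝓝 (1 - ρ)) := by
      simpa using ((tendsto_const_div_atTop_nhds_zero_nat (1 - ρ)).const_sub (1 - ρ)).sub hsqrt
    refine tendsto_of_tendsto_of_tendsto_of_le_of_le' (hlow.comp 𝒞.tendsto_len)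
      tendsto_const_nhds ?_ (Eventually.of_forall fun k => ?_)
    · filter_upwards [𝒞.tendsto_len.eventually_gt_atTop N] with k hk
      have hk : N < len k := hk
      -- Minimality: length `len k - 1` is still at least `N`, so it must violate the rate
      -- condition.
      have h3 := hmin k (len k - 1) (by omega) (by omega)
      rw [Nat.cast_sub (by omega)] at h3
      have h4 : √((len k : ℝ) - (1 : ℕ)) ≤ √(len k : ℝ) := Real.sqrt_le_sqrt (by simp)
      have h5 := hpos k
      change (1 - ρ) - (1 - ρ) / (len k : ℝ) - √(len k : ℝ) / len k ≤ (k : ℝ) / len k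
      rw [le_div_iff₀ (by linarith), sub_mul, sub_mul, div_mul_cancel₀ _ (by linarith),
        div_mul_cancel₀ _ (by linarith)]
      push_cast at h3
      push_cast at h4
      linarith
    · have h5 := hpos k
      change (k : ℝ) / len k ≤ 1 - ρ
      rw [div_le_iff₀ (by linarith)]
      linarith [(hlen k).2, Real.sqrt_nonneg (len k : ℝ)]

/-- A set of rates achieved by families has supremum `1 - ρ` if the converse bound applies to all
its members and, for `ρ < 1`, it contains this value. -/
theorem sSup_achievedRate_eq {ρ : ℝ} (h1 : ρ ≤ 1) {s : Set ℝ}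
    (hs : ∀ R ∈ s, 0 ≤ R ∧ R ≤ 1 - ρ) (hmem : ρ < 1 → 1 - ρ ∈ s) : sSup s = 1 - ρ := by
  rcases h1.lt_or_eq with h | rfl
  · exact IsGreatest.csSup_eq ⟨hmem h, fun R hR => (hs R hR).2⟩
  · rw [sub_self] at *
    exact le_antisymm (Real.sSup_nonpos fun R hR => (hs R hR).2)
      (Real.sSup_nonneg fun R hR => (hs R hR).1)

end WtII

theorem theorem5p1 (ρ : ℝ) (h0 : 0 ≤ ρ) (h1 : ρ ≤ 1) :
    WtII.capacity ρ = 1 - ρ ∧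
      (∀ ε : ℝ, 0 < ε → ε < 1 → WtII.capacityAtError ρ ε = 1 - ρ) ∧
      (ρ < 1 → ∃ (𝒞 : WtII.CodeFamily) (ε : ℕ → ℝ),
        Filter.Tendsto ε Filter.atTop (nhds 0) ∧ 𝒞.IsActive ρ ε ∧
          Filter.Tendsto 𝒞.rate Filter.atTop (nhds (1 - ρ))) := by
  refine ⟨WtII.sSup_achievedRate_eq h1 ?_ fun hρ => ?_, fun ε hε hε1 =>
    WtII.sSup_achievedRate_eq h1 ?_ fun hρ => ?_, fun hρ => ?_⟩
  · rintro R ⟨𝒞, ε, hε, h𝒞, rfl⟩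
    -- Vanishing errors are eventually at most `1 / 2`; any constant strictly between `0` and `1`
    -- would serve.
    exact ⟨𝒞.achievedRate_nonneg, h𝒞.achievedRate_le h0 h1 one_half_lt_one
      (hε.eventually_le_const one_half_pos)⟩
  · obtain ⟨𝒞, ε, -, hε, h𝒞, hr⟩ :=
      WtII.exists_capacity_achieving_family ρ h0 hρ 1 one_pos
    exact ⟨𝒞, ε, hε, h𝒞, hr.limsup_eq⟩
  · rintro R ⟨𝒞, h𝒞, rfl⟩
    exact ⟨𝒞.achievedRate_nonneg, h𝒞.achievedRate_le h0 h1 hε1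
      (Filter.Eventually.of_forall fun _ => le_rfl)⟩
  · obtain ⟨𝒞, ε', hle, -, ⟨p, hp⟩, hr⟩ :=
      WtII.exists_capacity_achieving_family ρ h0 hρ ε hε
    exact ⟨𝒞, ⟨p, fun k => (hp k).mono (hle k)⟩, hr.limsup_eq⟩
  · obtain ⟨𝒞, ε, -, hε, h𝒞, hr⟩ :=
      WtII.exists_capacity_achieving_family ρ h0 hρ 1 one_pos
    exact ⟨𝒞, ε, hε, h𝒞, hr⟩
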